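/- All graphs called simple below are finite. Let $\Gamma$ be a simple graph of girth $g$. For an edge $e$ let $\epsilon(e)$ be the number of cycles of length $g$ in $\Gamma$ that contain $e$. The signature of a vertex is the list of the numbers $\epsilon(e)$, for the edges $e$ incident to it, in non-decreasing order; $\Gamma$ is girth-regular if all its vertices have the same signature, which is then called the signature of $\Gamma$. A map is a cellular embedding of a finite connected graph (its skeleton, which may have loops and parallel edges) in a closed connected surface, orientable or not, such that the boundary walk of each face (a face-cycle) traverses each edge at most once. It is described by its flags (the triangles of its barycentric subdivision) and the three fixed-point-free involutions $r_0,r_1,r_2$ that interchange the flags differing only in their vertex, edge or face, respectively; here $r_0r_2=r_2r_0$ is also fixed-point-free and $\langle r_0,r_1,r_2\rangle$ is transitive on the flags. An automorphism of the map is a permutation of the flags that commutes with $r_0,r_1,r_2$. The map is arc-transitive if its automorphisms act transitively on the arcs (edges with a choice of one of their two directions) of the skeleton, and is an $\{m,k\}$-map if every face-cycle has length $m$ and every vertex of the skeleton is the tail of exactly $k$ arcs. For two arcs $s,t$ of the skeleton with a common tail write $s\leftrightarrow t$ if their edges are consecutive, at that tail, on some face-cycle. If the relation $\leftrightarrow$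 is a dihedral scheme, that is, a $2$-regular simple graph on the set of arcs whose connected components are exactly the sets of arcs with a common tail, then the truncation of the map is the simple graph on the set of arcs in which two arcs are adjacent if they are mutually inverse or related by $\leftrightarrow$. Theorem. Let $\Gamma$ be a simple connected cubic girth-regular graph of girth $g$ with $n$ vertices and signature $(1,1,2)$. Then $g$ is even, and there is a map $\mathcal M$, all of whose face-cycles have length $g/2$ and whose relation $\leftrightarrow$ is a dihedral scheme, such that $\Gamma$ is isomorphic to the truncation of $\mathcal M$. In particular, $g/2$ divides $n$. Moreover, if $\Gamma$ is vertex-transitive, then this $\mathcal M$ is arc-transitive and is a $\{g/2,\ell\}$-map for some $\ell>g$. -/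

import Mathlib

universe u

/-! ### Girth cycles, signatures, girth-regular graphs -/

namespace SimpleGraph

variable {V : Type u}

/-- A subgraph of `Γ` is a girth cycle if it is a cycle whose length is the girth of `Γ`. -/
def IsGirthCycle (Γ : SimpleGraph V) (C : Γ.Subgraph) : Prop :=
  ∃ (v : V) (w : Γ.Walk v v), w.IsCycle ∧ w.length = Γ.girth ∧ C = w.toSubgraph

/-- `ε(e)`: the number of girth cycles of `Γ` that contain the edge `e`. -/
noncomputable def girthCycleCount (Γ : SimpleGraph V) (e : Sym2 V) : ℕ :=
  {C : Γ.Subgraph | Γ.IsGirthCycle C ∧ e ∈ C.edgeSet}.ncard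

/-- The signature of a vertex: the numbers `ε(e)`, for the edges `e` incident to the vertex,
listed in non-decreasing order. -/
noncomputable def signature (Γ : SimpleGraph V) [Fintype V] [DecidableEq V]
    [DecidableRel Γ.Adj] (v : V) : List ℕ :=
  ((Γ.incidenceFinset v).val.map Γ.girthCycleCount).sort (· ≤ ·)

/-- A graph is girth-regular if all of its vertices have the same signature. -/
def IsGirthRegular (Γ : SimpleGraph V) [Fintype V] [DecidableEq V] [DecidableRel Γ.Adj] : Prop :=
  ∀ u v : V, Γ.signature u = Γ.signature v

/-- A graph is vertex-transitive if its automorphism group is transitive on the vertices. -/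
def IsVertexTransitive (Γ : SimpleGraph V) : Prop :=
  ∀ u v : V, ∃ φ : Γ ≃g Γ, φ u = v

end SimpleGraph

/-! ### Graphs with parallel edges and loops, dihedral schemes, truncations -/

/-- A graph with parallel edges and loops allowed, given by its vertices and arcs. An edge is a pair
`{a, inv a}` of mutually inverse arcs, and its end-vertices are `tail a` and `tail (inv a)`. -/
structure ArcGraph (V A : Type u) where
  tail : A → V
  inv : A → A
  inv_inv : ∀ a, inv (inv a) = a
  inv_ne : ∀ a, inv a ≠ a

namespace ArcGraph

variable {V A : Type u}

/-- The valence of a vertex: the number of arcs with that tail. -/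
noncomputable def valence (Λ : ArcGraph V A) (v : V) : ℕ :=
  {a : A | Λ.tail a = v}.ncard

/-- A dihedral scheme: an irreflexive symmetric relation on the arcs that is a `2`-regular graph
whose connected components are the sets of arcs with a common tail. -/
def IsDihedralScheme (Λ : ArcGraph V A) (R : SimpleGraph A) : Prop :=
  (∀ a : A, (R.neighborSet a).ncard = 2) ∧
    ∀ a b : A, R.Reachable a b ↔ Λ.tail a = Λ.tail b

/-- The truncation of a graph with respect to a dihedral scheme: the vertices are the arcs, and two
arcs are adjacent if they are related by the scheme or are inverse to each other. -/
def truncation (Λ : ArcGraph V A) (R : SimpleGraph A) : SimpleGraph A where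
  Adj s t := R.Adj s t ∨ t = Λ.inv s
  symm := ⟨fun s t h => by
    rcases h with h | h
    · exact Or.inl h.symm
    · exact Or.inr (by rw [h, Λ.inv_inv])⟩
  loopless := ⟨fun s h => by
    rcases h with h | h
    · exact R.irrefl h
    · exact Λ.inv_ne s h.symm⟩

end ArcGraph

/-! ### Maps -/

/-- The equivalence relation whose classes are the orbits of the group generated by the
permutations in `S`. -/
def orbitSetoid {F : Type u} (S : Set (Equiv.Perm F)) : Setoid F :=
  MulAction.orbitRel (Subgroup.closure S) F

/-- A map on a closed connected surface (orientable or not), described by its flags.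

A flag is one of the triangles of the barycentric subdivision of the map; its corners are a vertex,
the midpoint of an edge and the centre of a face. The permutation `r i` sends each flag to the flag
on the other side of the side opposite to its corner of dimension `i`; thus `r 0`, `r 1`, `r 2`
change, respectively, the vertex, the edge and the face of the flag, and keep the other two.

* Finitely many triangles glued in pairs along all of their sides, connectedly, around edge
  midpoints where exactly four triangles meet, form a closed connected surface with an embedded
  graph whose complement consists of open disks, and every such embedding arises so.
* As in the construction of a map by gluing disks along simple closed walks, `face_simple` says
  that the boundary walk of a face traverses no edge twice: the two sides of an edge lie in
  different faces. -/
structure SurfaceMap (F : Type u) where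
  r : Fin 3 → Equiv.Perm F
  finite_flags : Finite F
  nonempty_flags : Nonempty F
  invol : ∀ i f, r i (r i f) = f
  free : ∀ i f, r i f ≠ f
  comm : ∀ f, r 0 (r 2 f) = r 2 (r 0 f)
  edge_free : ∀ f, r 0 (r 2 f) ≠ f
  connected : ∀ f f', orbitSetoid {r 0, r 1, r 2} f f'
  face_simple : ∀ f, ¬ orbitSetoid {r 0, r 1} f (r 2 f)

namespace SurfaceMap

variable {F : Type u} (M : SurfaceMap F)

/-- The vertices of a map. -/
def Vert : Type u := Quotient (orbitSetoid {M.r 1, M.r 2})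

/-- The arcs of the skeleton of a map: an arc is an edge with a choice of one of its two ends, and
is shared by the two flags at that end of the edge, one on each side. -/
def Arc : Type u := Quotient (orbitSetoid {M.r 2})

/-- The arc of a flag: its edge, with the vertex of the flag as its tail. -/
def arc (f : F) : M.Arc := Quotient.mk (orbitSetoid {M.r 2}) f

/-- The vertex of a flag. -/
def vert (f : F) : M.Vert := Quotient.mk (orbitSetoid {M.r 1, M.r 2}) f

theorem orbitSetoid_two_iff (f f' : F) :
    orbitSetoid {M.r 2} f f' ↔ f = f' ∨ f = M.r 2 f' := by
  constructor
  · rintro ⟨⟨σ, hσ⟩, rfl⟩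
    change σ f' = f' ∨ σ f' = M.r 2 f'
    have key : ∀ g, σ g = g ∨ σ g = M.r 2 g := by
      induction hσ using Subgroup.closure_induction with
      | mem x hx =>
        rw [Set.mem_singleton_iff] at hx
        subst hx
        exact fun g => Or.inr rfl
      | one => exact fun g => Or.inl rfl
      | mul x y _ _ hx hy =>
        intro g
        rw [Equiv.Perm.mul_apply]
        rcases hy g with h | h <;> rw [h]
        · exact hx g
        · rcases hx (M.r 2 g) with h' | h' <;> rw [h']
          · exact Or.inr rfl
          · exact Or.inl (M.invol 2 g)
      | inv x _ hx =>
        intro g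
        rcases hx (x⁻¹ g) with h | h
        · left
          simpa using h.symm
        · right
          have h2 : g = M.r 2 (x⁻¹ g) := by simpa using h
          calc x⁻¹ g = M.r 2 (M.r 2 (x⁻¹ g)) := (M.invol 2 _).symm
            _ = M.r 2 g := by rw [← h2]
    exact key f'
  · rintro (rfl | rfl)
    · exact (orbitSetoid {M.r 2}).refl _
    · exact ⟨⟨M.r 2, Subgroup.subset_closure rfl⟩, rfl⟩

theorem arc_eq_iff (f f' : F) : M.arc f = M.arc f' ↔ f = f' ∨ f = M.r 2 f' :=
  Quotient.eq.trans (M.orbitSetoid_two_iff f f')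

theorem orbitSetoid_tail {f f' : F} (h : orbitSetoid {M.r 2} f f') :
    orbitSetoid {M.r 1, M.r 2} f f' := by
  rcases (M.orbitSetoid_two_iff f f').1 h with rfl | rfl
  · exact (orbitSetoid {M.r 1, M.r 2}).refl _
  · exact ⟨⟨M.r 2, Subgroup.subset_closure (Or.inr rfl)⟩, rfl⟩

theorem orbitSetoid_inv {f f' : F} (h : orbitSetoid {M.r 2} f f') :
    orbitSetoid {M.r 2} (M.r 0 f) (M.r 0 f') := by
  rw [M.orbitSetoid_two_iff] at h ⊢
  rcases h with rfl | rfl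
  · exact Or.inl rfl
  · exact Or.inr (M.comm f')

/-- The skeleton of a map. -/
def skeleton : ArcGraph M.Vert M.Arc where
  tail := Quotient.lift M.vert fun _ _ h => Quotient.sound (M.orbitSetoid_tail h)
  inv := Quotient.lift (fun f => M.arc (M.r 0 f)) fun _ _ h => Quotient.sound (M.orbitSetoid_inv h)
  inv_inv := by
    rintro ⟨f⟩
    exact congrArg M.arc (M.invol 0 f)
  inv_ne := by
    rintro ⟨f⟩ h
    rcases (M.arc_eq_iff (M.r 0 f) f).1 h with h | h
    · exact M.free 0 f h
    · apply M.edge_free f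
      rw [← h, M.invol]

/-- The face-cycle of a map that starts along the arc of the flag `f` and runs around the face of
`f`: the sequence of the arcs traversed. At each step, `r 0` moves to the other end of the current
edge and `r 1` turns to the next edge of the face. -/
def faceCycle (f : F) (i : ℕ) : M.Arc := M.arc (((M.r 1 * M.r 0) ^ i) f)

/-- The length of the face-cycle starting at the flag `f`: the number of steps after which the walk
around the face first returns to `f`. -/
noncomputable def faceLength (f : F) : ℕ := Function.minimalPeriod (M.r 1 * M.r 0) f

/-- The relation `↔` on the arcs of the skeleton: two arcs with a common tail are related if their
edges are consecutive on some face-cycle, there at that common tail. For consecutive arcs `a`, `b`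
of a face-cycle these are the arcs `inv a` and `b`. -/
def scheme : SimpleGraph M.Arc :=
  SimpleGraph.fromRel fun s t =>
    ∃ (f : F) (i : ℕ), s = M.skeleton.inv (M.faceCycle f i) ∧ t = M.faceCycle f (i + 1)

/-- The truncation of a map. -/
def truncation : SimpleGraph M.Arc := M.skeleton.truncation M.scheme

/-- All face-cycles have length `m`. -/
def HasFaceLength (m : ℕ) : Prop := ∀ f : F, M.faceLength f = m

/-- An `{m, k}`-map: all face-cycles have length `m` and the skeleton is `k`-regular. -/
def IsOfType (m k : ℕ) : Prop :=
  M.HasFaceLength m ∧ ∀ v : M.Vert, M.skeleton.valence v = k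

/-- The automorphism group of a map: the permutations of the flags that respect the gluing. -/
def Aut : Subgroup (Equiv.Perm F) := Subgroup.centralizer (Set.range M.r)

/-- A map is arc-transitive if its automorphism group is transitive on the arcs of the skeleton. -/
def IsArcTransitive : Prop := ∀ f f' : F, ∃ φ ∈ M.Aut, M.arc (φ f) = M.arc f'

end SurfaceMap

/-! # Cubic girth-regular graphs of signature `(1, 1, 2)` are truncations of maps -/

/-! A girth cycle through a vertex `v` uses exactly two of the three edges at `v`. Let these edges
`a`, `b`, `c` have `ε = 1, 1, 2`, and let `x_ab`, `x_ac`, `x_bc` count the girth cycles through each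
pair. Then `x_ab + x_ac = 1`, `x_ab + x_bc = 1` and `x_ac + x_bc = 2`, so `x_ab = 0` and `x_ac =
x_bc = 1` (`local_structure`). Hence the edges with `ε = 2` form a perfect matching (`mate`), girth
cycles alternate between matching edges and the other, "side" edges, and `v` lies on exactly two
girth cycles, which share the matching edge at `v`.

The pairs (vertex, girth cycle through it) therefore serve as flags: `r 0` moves along the matching
edge, `r 1` along the side edge of the cycle, and `r 2` switches to the other cycle. The faces are
the girth cycles, the arcs are the vertices of `Γ` with `mate` as inversion, the scheme is the graph
of side edges, and the vertices of the map are its components. Matching and side edges together give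
back `Γ` as the truncation.

A face has `g` flags and is an orbit of two free involutions, so its rotation has period `g / 2` and
`g` is even. Counting flags by vertex and by cycle gives `2n = g · #cycles`. Automorphisms of `Γ`
preserve `ε`, hence act on the map, which turns vertex-transitivity into arc-transitivity. The
valence is the length of a cycle of side edges: at least `g`, and not `g`, because a girth cycle
contains matching edges. -/

/-! ### Orbits of permutation groups -/

theorem orbitSetoid_generator {F : Type u} {S : Set (Equiv.Perm F)} {σ : Equiv.Perm F}
    (hσ : σ ∈ S) (f : F) : orbitSetoid S (σ f) f :=
  ⟨⟨σ, Subgroup.subset_closure hσ⟩, rfl⟩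

/-- The orbit relation is the least equivalence containing the moves of the generators. Invariants
of faces and vertices of the map are obtained by taking for `T` the pullback of an equivalence along
a function on flags. -/
theorem orbitSetoid_le {F : Type u} {S : Set (Equiv.Perm F)} (T : Setoid F)
    (hT : ∀ σ ∈ S, ∀ f, T (σ f) f) {f f' : F} (h : orbitSetoid S f f') : T f f' := by
  obtain ⟨⟨σ, hσ⟩, rfl⟩ := h
  change T (σ f') f'
  have key : ∀ g, T (σ g) g := by
    induction hσ using Subgroup.closure_induction with
    | mem x hx => exact hT x hx
    | one => exact fun g => T.refl g
    | mul x y _ _ hx hy => exact fun g => T.trans (hx (y g)) (hy g)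
    | inv x _ hx => exact fun g => T.symm (by simpa using hx (x⁻¹ g))
  exact key f'

theorem ncard_orbit_zpowers {F : Type u} [Finite F] (σ : Equiv.Perm F) (x : F) :
    {y | ∃ i : ℤ, (σ ^ i) x = y}.ncard = Function.minimalPeriod σ x := by
  classical
  have := Fintype.ofFinite F
  have e : {y | ∃ i : ℤ, (σ ^ i) x = y} = MulAction.orbit (Subgroup.zpowers σ) x := by
    ext y
    constructor
    · rintro ⟨i, rfl⟩
      exact ⟨⟨σ ^ i, i, rfl⟩, rfl⟩
    · rintro ⟨⟨_, i, rfl⟩, rfl⟩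
      exact ⟨i, rfl⟩
  have h := MulAction.minimalPeriod_eq_card (a := σ) (b := x)
  rw [e, Set.ncard_eq_toFinset_card', Set.toFinset_card]
  exact h.symm

/-- The orbits of a dihedral group generated by two fixed-point-free involutions consist of two
orbits of the rotations. -/
theorem ncard_orbit_of_free_involutions {F : Type u} [Finite F] (a b : Equiv.Perm F)
    (ha : ∀ f, a (a f) = f) (hb : ∀ f, b (b f) = f) (fa : ∀ f, a f ≠ f) (fb : ∀ f, b f ≠ f)
    (x : F) : {y | orbitSetoid {a, b} y x}.ncard = 2 * Function.minimalPeriod (b * a) x := by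
  set ρ := b * a with hρ
  have ainv : a⁻¹ = a := by ext f; rw [Equiv.Perm.inv_eq_iff_eq, ha]
  have binv : b⁻¹ = b := by ext f; rw [Equiv.Perm.inv_eq_iff_eq, hb]
  have aρ : a * ρ * a⁻¹ = ρ⁻¹ := by rw [hρ, mul_inv_rev, ainv, binv]; ext f; simp [ha]
  have conj : ∀ (i : ℤ) f, a ((ρ ^ i) f) = (ρ ^ (-i)) (a f) := by
    intro i f
    have h1 : a * ρ ^ i * a⁻¹ = ρ ^ (-i) := by
      rw [← conj_zpow, aρ, inv_zpow, zpow_neg]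
    rw [← h1]; simp
  have bρ : ∀ f, b f = ρ (a f) := fun f => by simp [hρ, ha]
  have add : ∀ (i j : ℤ) f, (ρ ^ i) ((ρ ^ j) f) = (ρ ^ (i + j)) f := fun i j f => by
    rw [zpow_add]; rfl
  have one : ∀ f, ρ f = (ρ ^ (1 : ℤ)) f := fun f => by simp
  set O : F → Set F := fun z => {y | ∃ i : ℤ, (ρ ^ i) z = y} with hO
  have disj : Disjoint (O x) (O (a x)) := by
    rw [Set.disjoint_left]
    rintro y ⟨i, rfl⟩ ⟨j, hj⟩
    -- a rotation maps `x` to its image under a reflection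
    have hk : a x = (ρ ^ (i - j)) x := by
      have := congrArg (ρ ^ (-j)) hj
      rw [add, add] at this
      simpa [sub_eq_neg_add] using this
    -- Every reflection is conjugate to `a` or to `b`, according to parity: `a x = ρ ^ (2k) x` makes
    -- `ρ ^ k x` a fixed point of `a`, and `a x = ρ ^ (2k + 1) x` makes `ρ ^ (k + 1) x` a fixed
    -- point of `b`.
    obtain ⟨k, hk' | hk'⟩ := Int.even_or_odd' (i - j)
    · apply fa ((ρ ^ k) x)
      rw [conj, hk, add]
      congr 2; omega
    · apply fb ((ρ ^ (k + 1)) x)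
      rw [bρ, conj, hk, one, add, add]
      congr 2; omega
  have union : {y | orbitSetoid {a, b} y x} = O x ∪ O (a x) := by
    have step : ∀ z, O (a x) z → O x (a z) := by
      rintro _ ⟨i, rfl⟩
      exact ⟨-i, by rw [conj, ha]⟩
    have step' : ∀ z, O x z → O (a x) (a z) := by
      rintro _ ⟨i, rfl⟩
      exact ⟨-i, by rw [conj]⟩
    have stepρ : ∀ w z, O w z → O w (ρ z) := by
      rintro w _ ⟨i, rfl⟩
      exact ⟨1 + i, by rw [← add, ← one]⟩
    have hP : ∀ σ ∈ ({a, b} : Set (Equiv.Perm F)), ∀ z, z ∈ O x ∪ O (a x) →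
        σ z ∈ O x ∪ O (a x) := by
      rintro σ (rfl | rfl) z (hz | hz)
      · exact Or.inr (step' z hz)
      · exact Or.inl (step z hz)
      · rw [bρ]; exact Or.inr (stepρ _ _ (step' z hz))
      · rw [bρ]; exact Or.inl (stepρ _ _ (step z hz))
    have hP' : ∀ σ ∈ ({a, b} : Set (Equiv.Perm F)), ∀ z, σ z ∈ O x ∪ O (a x) ↔
        z ∈ O x ∪ O (a x) := by
      intro σ hσ z
      refine ⟨fun hz => ?_, hP σ hσ z⟩
      have := hP σ hσ _ hz
      rcases hσ with rfl | rfl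
      · rwa [ha] at this
      · rwa [hb] at this
    have xin : x ∈ O x := ⟨0, by simp⟩
    ext y
    constructor
    · intro hy
      -- Having the same truth value of membership in the union is an equivalence relation, and the
      -- generators respect it.
      have := orbitSetoid_le (Setoid.comap (fun z => z ∈ O x ∪ O (a x)) ⊥)
        (fun σ hσ f => propext (hP' σ hσ f)) hy
      exact (iff_of_eq this).2 (Or.inl xin)
    · have hρ' : ∀ w, ∀ z ∈ O w, orbitSetoid {a, b} z w := by
        rintro w _ ⟨i, rfl⟩
        have hmem : ρ ^ i ∈ Subgroup.closure {a, b} :=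
          Subgroup.zpow_mem _ (Subgroup.mul_mem _ (Subgroup.subset_closure (by simp))
            (Subgroup.subset_closure (by simp))) _
        exact ⟨⟨_, hmem⟩, rfl⟩
      rintro (hy | hy)
      · exact hρ' _ _ hy
      · exact (orbitSetoid {a, b}).trans (hρ' _ _ hy) (orbitSetoid_generator (by simp) x)
  have image : O (a x) = a '' O x := by
    ext y
    constructor
    · rintro ⟨i, rfl⟩
      exact ⟨(ρ ^ (-i)) x, ⟨-i, rfl⟩, by rw [conj, neg_neg]⟩
    · rintro ⟨_, ⟨i, rfl⟩, rfl⟩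
      exact ⟨-i, by rw [conj]⟩
  rw [union, Set.ncard_union_eq disj, image, Set.ncard_image_of_injective _ a.injective,
    ncard_orbit_zpowers, two_mul]

namespace SimpleGraph

variable {V : Type u} {Γ : SimpleGraph V}

/-! ### Girth cycles -/

theorem IsGirthCycle.ncard_neighborSet {C : Γ.Subgraph} (hC : Γ.IsGirthCycle C) {v : V}
    (hv : v ∈ C.verts) : (C.neighborSet v).ncard = 2 := by
  obtain ⟨u, w, hw, -, rfl⟩ := hC
  exact hw.ncard_neighborSet_toSubgraph_eq_two (w.mem_verts_toSubgraph.1 hv)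

theorem Walk.IsCycle.ncard_verts_toSubgraph {u : V} {w : Γ.Walk u u} (hw : w.IsCycle) :
    w.toSubgraph.verts.ncard = w.length := by
  classical
  have h : w.toSubgraph.verts = (w.support.tail.toFinset : Set V) := by
    ext x
    simp only [Walk.mem_verts_toSubgraph, List.coe_toFinset, Set.mem_ofPred_eq]
    refine ⟨fun hx => ?_, fun hx => List.mem_of_mem_tail hx⟩
    rcases (Walk.mem_support_iff w).1 hx with rfl | hx
    · exact Walk.end_mem_tail_support hw.not_nil
    · exact hx
  rw [h, Set.ncard_coe_finset, List.toFinset_card_of_nodup hw.support_nodup, List.length_tail,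
    Walk.length_support, Nat.add_sub_cancel]

theorem IsGirthCycle.ncard_verts {C : Γ.Subgraph} (hC : Γ.IsGirthCycle C) :
    C.verts.ncard = Γ.girth := by
  obtain ⟨u, w, hw, h, rfl⟩ := hC
  rw [hw.ncard_verts_toSubgraph, h]

theorem IsGirthCycle.connected {C : Γ.Subgraph} (hC : Γ.IsGirthCycle C) : C.Connected := by
  obtain ⟨u, w, hw, h, rfl⟩ := hC
  exact w.toSubgraph_connected

theorem IsGirthCycle.map {C : Γ.Subgraph} (hC : Γ.IsGirthCycle C) (φ : Γ ≃g Γ) :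
    Γ.IsGirthCycle (C.map φ.toHom) := by
  obtain ⟨u, w, hw, h, rfl⟩ := hC
  exact ⟨φ.toHom u, w.map φ.toHom, hw.map φ.injective, by rw [Walk.length_map, h],
    (Walk.toSubgraph_map φ.toHom w).symm⟩

/-! ### Cubic graphs of signature `(1, 1, 2)` -/

/-- Every vertex has exactly three neighbours, joined to it by edges that lie on one, one and two
girth cycles. -/
def HasSignatureOneOneTwo (Γ : SimpleGraph V) : Prop :=
  ∀ v, ∃ a b c, a ≠ b ∧ a ≠ c ∧ b ≠ c ∧ Γ.neighborSet v = {a, b, c} ∧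
    Γ.girthCycleCount s(v, a) = 1 ∧ Γ.girthCycleCount s(v, b) = 1 ∧
    Γ.girthCycleCount s(v, c) = 2

theorem hasSignatureOneOneTwo_of_signature_eq [Fintype V] [DecidableEq V] [DecidableRel Γ.Adj]
    (hsig : ∀ v, Γ.signature v = [1, 1, 2]) : Γ.HasSignatureOneOneTwo := by
  intro v
  have h1 : (Γ.incidenceFinset v).val.map Γ.girthCycleCount = ([1, 1, 2] : List ℕ) := by
    rw [← hsig v, signature, Multiset.sort_eq]
  have h2 : (Γ.incidenceFinset v) = (Γ.neighborFinset v).image (fun w => s(v, w)) := by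
    ext e
    induction e with | h x y
    simp only [mem_incidenceFinset, Finset.mem_image, mem_neighborFinset, incidenceSet,
      Set.mem_ofPred_eq, mem_edgeSet, Sym2.mem_iff]
    constructor
    · rintro ⟨h, rfl | rfl⟩
      · exact ⟨y, h, rfl⟩
      · exact ⟨x, h.symm, Sym2.eq_swap⟩
    · rintro ⟨w, hw, h⟩
      rw [Sym2.eq_iff] at h
      rcases h with ⟨rfl, rfl⟩ | ⟨rfl, rfl⟩
      · exact ⟨hw, Or.inl rfl⟩
      · exact ⟨hw.symm, Or.inr rfl⟩
  have hinj : Function.Injective (fun w => s(v, w)) := fun x y h => Sym2.congr_right.1 h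
  rw [h2, Finset.image_val_of_injOn hinj.injOn, Multiset.map_map] at h1
  obtain ⟨a, ha, ha1, h3⟩ := (Multiset.map_eq_cons _ _ ([1, 2] : List ℕ) 1).2 h1
  obtain ⟨b, hb, hb1, h4⟩ := (Multiset.map_eq_cons _ _ ([2] : List ℕ) 1).2 h3
  obtain ⟨c, hc, hc1, h5⟩ := (Multiset.map_eq_cons _ _ ([] : List ℕ) 2).2 h4
  have h6 : (Γ.neighborFinset v).val = a ::ₘ b ::ₘ c ::ₘ 0 := by
    rw [← Multiset.cons_erase ha, ← Multiset.cons_erase hb, ← Multiset.cons_erase hc,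
      Multiset.map_eq_zero.1 h5]
  have h7 := (Γ.neighborFinset v).nodup
  rw [h6] at h7
  simp only [Multiset.nodup_cons, Multiset.mem_cons, Multiset.notMem_zero, or_false, not_or] at h7
  refine ⟨a, b, c, h7.1.1, h7.1.2, h7.2.1, ?_, ha1, hb1, hc1⟩
  ext w
  rw [mem_neighborSet, ← mem_neighborFinset, ← Finset.mem_val, h6]
  simp

namespace HasSignatureOneOneTwo

theorem existsUnique_mate (h : Γ.HasSignatureOneOneTwo) (v : V) :
    ∃! c, Γ.Adj v c ∧ Γ.girthCycleCount s(v, c) = 2 := by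
  obtain ⟨a, b, c, -, -, -, hN, h1, h2, h3⟩ := h v
  have hN' : ∀ w, Γ.Adj v w ↔ w = a ∨ w = b ∨ w = c := fun w => by
    rw [← mem_neighborSet, hN]; rfl
  refine ⟨c, ⟨(hN' c).2 (by simp), h3⟩, ?_⟩
  rintro w ⟨hw, hw2⟩
  rcases (hN' w).1 hw with rfl | rfl | rfl
  · omega
  · omega
  · rfl

/-- The neighbour of `v` along the edge that lies on two girth cycles. -/
noncomputable def mate (h : Γ.HasSignatureOneOneTwo) (v : V) : V := (h.existsUnique_mate v).choose

variable (h : Γ.HasSignatureOneOneTwo)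
include h

theorem adj_mate (v : V) : Γ.Adj v (h.mate v) := (h.existsUnique_mate v).choose_spec.1.1

theorem girthCycleCount_mate (v : V) : Γ.girthCycleCount s(v, h.mate v) = 2 :=
  (h.existsUnique_mate v).choose_spec.1.2

theorem eq_mate {v w : V} (hw : Γ.Adj v w) (hw2 : Γ.girthCycleCount s(v, w) = 2) :
    w = h.mate v :=
  (h.existsUnique_mate v).choose_spec.2 w ⟨hw, hw2⟩

-- The number `ε` belongs to the unordered edge, so an edge selected at one end is also selected at
-- the other.
@[simp] theorem mate_mate (v : V) : h.mate (h.mate v) = v :=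
  (h.eq_mate (h.adj_mate v).symm (by rw [Sym2.eq_swap]; exact h.girthCycleCount_mate v)).symm

/-- Two of the three edges at `v` lie on each girth cycle through `v`; the counts 1, 1, 2 leave only
one distribution of cycles over the pairs of edges. -/
theorem local_structure (v : V) : ∃ (a b : V) (A B : Γ.Subgraph), a ≠ b ∧ a ≠ h.mate v ∧
    b ≠ h.mate v ∧ Γ.neighborSet v = {a, b, h.mate v} ∧ Γ.IsGirthCycle A ∧ Γ.IsGirthCycle B ∧
    A.neighborSet v = {a, h.mate v} ∧ B.neighborSet v = {b, h.mate v} ∧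
    ∀ C, Γ.IsGirthCycle C → v ∈ C.verts → C = A ∨ C = B := by
  obtain ⟨a, b, c, hab, hac, hbc, hN, h1, h2, h3⟩ := h v
  have hN' : ∀ w, Γ.Adj v w ↔ w = a ∨ w = b ∨ w = c := fun w => by
    rw [← mem_neighborSet, hN]; rfl
  have hc : c = h.mate v := h.eq_mate ((hN' c).2 (by simp)) h3
  obtain ⟨A, hA⟩ := Set.ncard_eq_one.1 h1
  obtain ⟨B, hB⟩ := Set.ncard_eq_one.1 h2
  obtain ⟨D, E, hDE, hD⟩ := Set.ncard_eq_two.1 h3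
  have hA' : ∀ C, (Γ.IsGirthCycle C ∧ C.Adj v a) ↔ C = A := fun C => Set.ext_iff.1 hA C
  have hB' : ∀ C, (Γ.IsGirthCycle C ∧ C.Adj v b) ↔ C = B := fun C => Set.ext_iff.1 hB C
  have hD' : ∀ C, (Γ.IsGirthCycle C ∧ C.Adj v c) ↔ C = D ∨ C = E := fun C => Set.ext_iff.1 hD C
  -- a girth cycle through `v` uses exactly two of the three edges
  have key : ∀ C, Γ.IsGirthCycle C → v ∈ C.verts →
      C.neighborSet v = {a, b} ∨ C.neighborSet v = {a, c} ∨ C.neighborSet v = {b, c} := by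
    intro C hC hv
    obtain ⟨x, y, hxy, hx⟩ := Set.ncard_eq_two.1 (hC.ncard_neighborSet hv)
    have hx' : Γ.Adj v x := C.adj_sub (show x ∈ C.neighborSet v by rw [hx]; simp)
    have hy' : Γ.Adj v y := C.adj_sub (show y ∈ C.neighborSet v by rw [hx]; simp)
    rw [hx]
    rcases (hN' x).1 hx' with rfl | rfl | rfl <;> rcases (hN' y).1 hy' with rfl | rfl | rfl <;>
      simp_all [Set.pair_comm]
  have adj_of : ∀ {C : Γ.Subgraph} {x y z : V}, C.neighborSet v = {x, y} →
      (C.Adj v z ↔ z = x ∨ z = y) := fun {C x y z} hx => by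
    rw [← Subgraph.mem_neighborSet, hx]; rfl
  obtain ⟨gA, aA⟩ := (hA' A).2 rfl
  obtain ⟨gB, aB⟩ := (hB' B).2 rfl
  have vA := A.edge_vert aA
  have vB := B.edge_vert aB
  have hcs : ∀ C, Γ.IsGirthCycle C → C.Adj v c → C = A ∨ C = B := by
    intro C hC hvc
    rcases key C hC (C.edge_vert hvc) with e | e | e
    · exact Or.inl ((hA' C).1 ⟨hC, (adj_of e).2 (by simp)⟩)
    · exact Or.inl ((hA' C).1 ⟨hC, (adj_of e).2 (by simp)⟩)
    · exact Or.inr ((hB' C).1 ⟨hC, (adj_of e).2 (by simp)⟩)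
  -- If `A` used both single edges, it would be the only girth cycle on either. The two cycles
  -- through `c` each use a second edge at `v`, so both would equal `A`.
  have nab : A.neighborSet v ≠ {a, b} := by
    intro e
    have hAB : A = B := (hB' A).1 ⟨gA, (adj_of e).2 (by simp)⟩
    obtain ⟨gD, aD⟩ := (hD' D).2 (Or.inl rfl)
    obtain ⟨gE, aE⟩ := (hD' E).2 (Or.inr rfl)
    have h1 := hcs D gD aD
    have h2 := hcs E gE aE
    apply hDE
    rw [← hAB] at h1 h2
    rw [h1.elim id id, h2.elim id id]
  have nba : B.neighborSet v ≠ {a, b} := by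
    intro e
    have hAB : B = A := (hA' B).1 ⟨gB, (adj_of e).2 (by simp)⟩
    exact nab (hAB ▸ e)
  have eA : A.neighborSet v = {a, c} := by
    rcases key A gA vA with e | e | e
    · exact absurd e nab
    · exact e
    · exact absurd ((adj_of e).1 aA) (by simp [hab, hac])
  have eB : B.neighborSet v = {b, c} := by
    rcases key B gB vB with e | e | e
    · exact absurd e nba
    · exact absurd ((adj_of e).1 aB) (by simp [hab.symm, hbc])
    · exact e
  subst hc
  refine ⟨a, b, A, B, hab, hac, hbc, hN, gA, gB, eA, eB, ?_⟩
  intro C hC hv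
  rcases key C hC hv with e | e | e
  · exact Or.inl ((hA' C).1 ⟨hC, (adj_of e).2 (by simp)⟩)
  · exact Or.inl ((hA' C).1 ⟨hC, (adj_of e).2 (by simp)⟩)
  · exact Or.inr ((hB' C).1 ⟨hC, (adj_of e).2 (by simp)⟩)

theorem cycle_adj_mate {C : Γ.Subgraph} (hC : Γ.IsGirthCycle C) {v : V} (hv : v ∈ C.verts) :
    C.Adj v (h.mate v) := by
  obtain ⟨a, b, A, B, -, -, -, -, -, -, eA, eB, hAB⟩ := h.local_structure v
  rw [← Subgraph.mem_neighborSet]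
  rcases hAB C hC hv with rfl | rfl
  · rw [eA]; simp
  · rw [eB]; simp

theorem mate_mem {C : Γ.Subgraph} (hC : Γ.IsGirthCycle C) {v : V} (hv : v ∈ C.verts) :
    h.mate v ∈ C.verts :=
  C.edge_vert (h.cycle_adj_mate hC hv).symm

theorem existsUnique_side {C : Γ.Subgraph} (hC : Γ.IsGirthCycle C) {v : V} (hv : v ∈ C.verts) :
    ∃! w, C.Adj v w ∧ w ≠ h.mate v := by
  obtain ⟨a, b, A, B, -, ha, hb, -, -, -, eA, eB, hAB⟩ := h.local_structure v
  simp only [← Subgraph.mem_neighborSet]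
  rcases hAB C hC hv with rfl | rfl
  · rw [eA]; exact ⟨a, by simp [ha], by simp⟩
  · rw [eB]; exact ⟨b, by simp [hb], by simp⟩

theorem exists_two_cycles (v : V) : ∃ A B : Γ.Subgraph, A ≠ B ∧
    ∀ C, (Γ.IsGirthCycle C ∧ v ∈ C.verts) ↔ C = A ∨ C = B := by
  obtain ⟨a, b, A, B, hab, ha, hb, -, gA, gB, eA, eB, hAB⟩ := h.local_structure v
  have aA : A.Adj v a := by rw [← Subgraph.mem_neighborSet, eA]; simp
  have aB : B.Adj v b := by rw [← Subgraph.mem_neighborSet, eB]; simp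
  refine ⟨A, B, ?_, fun C => ⟨fun hC => hAB C hC.1 hC.2, ?_⟩⟩
  · rintro rfl
    have : b ∈ A.neighborSet v := aB
    rw [eA] at this
    simp [hab.symm, hb] at this
  · rintro (rfl | rfl)
    · exact ⟨gA, C.edge_vert aA⟩
    · exact ⟨gB, C.edge_vert aB⟩

theorem exists_cycle_adj {v w : V} (hvw : Γ.Adj v w) : ∃ C, Γ.IsGirthCycle C ∧ C.Adj v w := by
  obtain ⟨a, b, A, B, hab, ha, hb, hN, gA, gB, eA, eB, hAB⟩ := h.local_structure v
  simp only [← Subgraph.mem_neighborSet]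
  rw [← mem_neighborSet, hN] at hvw
  rcases hvw with rfl | rfl | rfl
  · exact ⟨A, gA, by rw [eA]; simp⟩
  · exact ⟨B, gB, by rw [eB]; simp⟩
  · exact ⟨A, gA, by rw [eA]; simp⟩

/-- The graph of the edges that lie on a single girth cycle. -/
def sideGraph : SimpleGraph V where
  Adj v w := Γ.Adj v w ∧ w ≠ h.mate v
  symm := ⟨fun v w hvw => ⟨hvw.1.symm, fun e => hvw.2 (by rw [e, h.mate_mate])⟩⟩
  loopless := ⟨fun _ hv => Γ.irrefl hv.1⟩

theorem sideGraph_adj {v w : V} : h.sideGraph.Adj v w ↔ Γ.Adj v w ∧ w ≠ h.mate v := Iff.rfl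

theorem ncard_neighborSet_sideGraph (v : V) : (h.sideGraph.neighborSet v).ncard = 2 := by
  obtain ⟨a, b, A, B, hab, ha, hb, hN, -⟩ := h.local_structure v
  have : h.sideGraph.neighborSet v = {a, b} := by
    ext w
    rw [mem_neighborSet, sideGraph_adj, ← mem_neighborSet, hN]
    simp only [Set.mem_insert_iff, Set.mem_singleton_iff]
    constructor
    · rintro ⟨h1 | h1 | h1, h2⟩
      · exact Or.inl h1
      · exact Or.inr h1
      · exact absurd h1 h2
    · rintro (rfl | rfl)
      · exact ⟨Or.inl rfl, ha⟩
      · exact ⟨Or.inr (Or.inl rfl), hb⟩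
  rw [this, Set.ncard_pair hab]

/-- A component of the 2-regular side graph is a cycle of `Γ`, so it has at least `g` vertices.
Equality would make it a girth cycle, which must contain matching edges, whereas the side graph has
none. -/
theorem girth_lt_ncard_reachable [Finite V] (v : V) :
    Γ.girth < {w | h.sideGraph.Reachable v w}.ncard := by
  classical
  have hcyc : h.sideGraph.IsCycles := fun x _ => h.ncard_neighborSet_sideGraph x
  have hne : (h.sideGraph.neighborSet v).Nonempty :=
    Set.nonempty_of_ncard_ne_zero (by rw [h.ncard_neighborSet_sideGraph]; decide)
  obtain ⟨p, hp, hpv⟩ := hcyc.exists_cycle_toSubgraph_verts_eq_connectedComponentSupp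
    (c := h.sideGraph.connectedComponentMk v) rfl hne
  have hset : {w | h.sideGraph.Reachable v w} = p.toSubgraph.verts := by
    rw [hpv]
    ext w
    simp only [Set.mem_ofPred_eq, ConnectedComponent.mem_supp_iff, ConnectedComponent.eq]
    exact ⟨fun e => e.symm, fun e => e.symm⟩
  rw [hset, hp.ncard_verts_toSubgraph]
  have hle : h.sideGraph ≤ Γ := fun x y hxy => hxy.1
  have hq := hp.mapLe hle
  have hlen : (p.mapLe hle).length = p.length := Walk.length_map _ _
  refine lt_of_le_of_ne (hlen ▸ girth_le_length hq) fun e => ?_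
  have hC : Γ.IsGirthCycle (p.mapLe hle).toSubgraph := ⟨v, _, hq, hlen.trans e.symm, rfl⟩
  have hadj := h.cycle_adj_mate hC (Walk.start_mem_verts_toSubgraph _)
  rw [Walk.adj_toSubgraph_mapLe] at hadj
  exact (p.toSubgraph.adj_sub hadj).2 rfl

end HasSignatureOneOneTwo

/-! ### Automorphisms preserve `ε` and the matching -/

theorem Subgraph.map_iso_injective (φ : Γ ≃g Γ) :
    Function.Injective fun C : Γ.Subgraph => C.map φ.toHom := by
  refine Function.LeftInverse.injective (g := fun C => C.map φ.symm.toHom) fun C => ?_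
  change (C.map φ.toHom).map φ.symm.toHom = C
  rw [← Subgraph.map_comp]
  convert C.map_id
  ext x
  exact φ.symm_apply_apply x

theorem girthCycleCount_map_le [Finite V] (φ : Γ ≃g Γ) (e : Sym2 V) :
    Γ.girthCycleCount e ≤ Γ.girthCycleCount (e.map φ) := by
  refine Set.ncard_le_ncard_of_injOn (fun C => C.map φ.toHom) ?_
    (Subgraph.map_iso_injective φ).injOn
    (Set.toFinite _)
  rintro C ⟨hC, he⟩
  refine ⟨hC.map φ, ?_⟩
  rw [Subgraph.edgeSet_map]
  exact ⟨e, he, rfl⟩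

theorem girthCycleCount_map [Finite V] (φ : Γ ≃g Γ) (e : Sym2 V) :
    Γ.girthCycleCount (e.map φ) = Γ.girthCycleCount e := by
  refine le_antisymm ?_ (girthCycleCount_map_le φ e)
  refine (girthCycleCount_map_le φ.symm _).trans_eq ?_
  congr 1
  induction e with | h x y
  simp

theorem HasSignatureOneOneTwo.map_mate [Finite V] (h : Γ.HasSignatureOneOneTwo) (φ : Γ ≃g Γ)
    (v : V) : φ (h.mate v) = h.mate (φ v) := by
  refine h.eq_mate (φ.map_adj_iff.2 (h.adj_mate v)) ?_
  rw [← h.girthCycleCount_mate v, ← girthCycleCount_map φ s(v, h.mate v)]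
  rfl

end SimpleGraph

theorem Nat.card_eq_mul_card_of_fibers {F X : Type u} [Finite F] [Finite X] (f : F → X) (k : ℕ)
    (hk : ∀ x, {y | f y = x}.ncard = k) : Nat.card F = k * Nat.card X := by
  have := Fintype.ofFinite X
  have hk' : ∀ x, Nat.card {y // f y = x} = k := hk
  rw [Nat.card_congr (Equiv.sigmaFiberEquiv f).symm, Nat.card_sigma]
  simp [hk', mul_comm]

/-! ### Flags and their three involutions -/

namespace SimpleGraph

variable {V : Type u} {Γ : SimpleGraph V}

/-- A girth cycle with a distinguished vertex. -/
@[ext] structure GirthFlag (Γ : SimpleGraph V) : Type u where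
  vertex : V
  cycle : Γ.Subgraph
  isGirthCycle : Γ.IsGirthCycle cycle
  mem : vertex ∈ cycle.verts

instance [Finite V] : Finite Γ.GirthFlag :=
  Finite.of_injective (fun f => (f.vertex, f.cycle)) fun f f' e => by
    rw [Prod.mk.injEq] at e
    exact GirthFlag.ext e.1 e.2

/-- The action of an automorphism of a graph on the girth cycles with a distinguished vertex. -/
def GirthFlag.map (φ : Γ ≃g Γ) (f : Γ.GirthFlag) : Γ.GirthFlag :=
  ⟨φ f.vertex, f.cycle.map φ.toHom, f.isGirthCycle.map φ, f.vertex, f.mem, rfl⟩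

theorem GirthFlag.map_injective (φ : Γ ≃g Γ) : Function.Injective (GirthFlag.map φ) :=
  fun _ _ e => GirthFlag.ext (φ.injective (congrArg GirthFlag.vertex e))
    (Subgraph.map_iso_injective φ (congrArg GirthFlag.cycle e))

/-- The action of an automorphism of the graph on the flags, as a permutation. -/
noncomputable def GirthFlag.mapPerm [Finite V] (φ : Γ ≃g Γ) : Equiv.Perm Γ.GirthFlag :=
  Equiv.ofBijective (GirthFlag.map φ)
    (Finite.injective_iff_bijective.1 (GirthFlag.map_injective φ))

theorem GirthFlag.ncard_cycle_eq {C : Γ.Subgraph} (hC : Γ.IsGirthCycle C) :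
    {f : Γ.GirthFlag | f.cycle = C}.ncard = Γ.girth := by
  rw [← hC.ncard_verts]
  have e : C.verts = GirthFlag.vertex '' {f : Γ.GirthFlag | f.cycle = C} := by
    ext v
    constructor
    · exact fun hv => ⟨⟨v, C, hC, hv⟩, rfl, rfl⟩
    · rintro ⟨f, rfl, rfl⟩
      exact f.mem
  rw [e, Set.InjOn.ncard_image]
  rintro f hf f' hf' e
  exact GirthFlag.ext e (hf.trans hf'.symm)

namespace HasSignatureOneOneTwo

variable (h : Γ.HasSignatureOneOneTwo)
include h

/-- Passing to the neighbour on the edge that lies on two girth cycles. -/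
noncomputable def mateFlag (f : Γ.GirthFlag) : Γ.GirthFlag :=
  ⟨h.mate f.vertex, f.cycle, f.isGirthCycle, h.mate_mem f.isGirthCycle f.mem⟩

/-- Passing to the neighbour on the edge of the girth cycle that lies on no other girth cycle. -/
noncomputable def sideFlag (f : Γ.GirthFlag) : Γ.GirthFlag :=
  ⟨(h.existsUnique_side f.isGirthCycle f.mem).choose, f.cycle, f.isGirthCycle,
    f.cycle.edge_vert (h.existsUnique_side f.isGirthCycle f.mem).choose_spec.1.1.symm⟩

theorem existsUnique_otherCycle (f : Γ.GirthFlag) :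
    ∃! C, (Γ.IsGirthCycle C ∧ f.vertex ∈ C.verts) ∧ C ≠ f.cycle := by
  obtain ⟨A, B, hAB, hC⟩ := h.exists_two_cycles f.vertex
  simp only [hC]
  rcases (hC f.cycle).1 ⟨f.isGirthCycle, f.mem⟩ with e | e <;> rw [e]
  · exact ⟨B, ⟨Or.inr rfl, hAB.symm⟩, fun C hC => hC.1.resolve_left hC.2⟩
  · exact ⟨A, ⟨Or.inl rfl, hAB⟩, fun C hC => hC.1.resolve_right hC.2⟩

/-- Passing to the other girth cycle through a vertex. -/
noncomputable def otherFlag (f : Γ.GirthFlag) : Γ.GirthFlag :=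
  ⟨f.vertex, (h.existsUnique_otherCycle f).choose,
    (h.existsUnique_otherCycle f).choose_spec.1.1.1,
    (h.existsUnique_otherCycle f).choose_spec.1.1.2⟩

theorem adj_sideFlag (f : Γ.GirthFlag) : f.cycle.Adj f.vertex (h.sideFlag f).vertex :=
  (h.existsUnique_side f.isGirthCycle f.mem).choose_spec.1.1

theorem sideFlag_ne_mate (f : Γ.GirthFlag) : (h.sideFlag f).vertex ≠ h.mate f.vertex :=
  (h.existsUnique_side f.isGirthCycle f.mem).choose_spec.1.2

theorem eq_sideFlag {f f' : Γ.GirthFlag} (hc : f'.cycle = f.cycle)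
    (ha : f.cycle.Adj f.vertex f'.vertex) (hn : f'.vertex ≠ h.mate f.vertex) :
    f' = h.sideFlag f :=
  GirthFlag.ext ((h.existsUnique_side f.isGirthCycle f.mem).choose_spec.2 _ ⟨ha, hn⟩) hc

theorem sideGraph_adj_sideFlag (f : Γ.GirthFlag) :
    h.sideGraph.Adj f.vertex (h.sideFlag f).vertex :=
  ⟨f.cycle.adj_sub (h.adj_sideFlag f), h.sideFlag_ne_mate f⟩

theorem otherFlag_cycle_ne (f : Γ.GirthFlag) : (h.otherFlag f).cycle ≠ f.cycle :=
  (h.existsUnique_otherCycle f).choose_spec.1.2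

theorem eq_otherFlag {f f' : Γ.GirthFlag} (hv : f'.vertex = f.vertex)
    (hc : f'.cycle ≠ f.cycle) : f' = h.otherFlag f :=
  GirthFlag.ext hv ((h.existsUnique_otherCycle f).choose_spec.2 _
    ⟨⟨f'.isGirthCycle, hv ▸ f'.mem⟩, hc⟩)

theorem mateFlag_mateFlag (f : Γ.GirthFlag) : h.mateFlag (h.mateFlag f) = f :=
  GirthFlag.ext (h.mate_mate _) rfl

theorem sideFlag_sideFlag (f : Γ.GirthFlag) : h.sideFlag (h.sideFlag f) = f := by
  refine (h.eq_sideFlag (f := h.sideFlag f) (f' := f) rfl (h.adj_sideFlag f).symm ?_).symm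
  exact (h.sideGraph_adj_sideFlag f).symm.2

theorem otherFlag_otherFlag (f : Γ.GirthFlag) : h.otherFlag (h.otherFlag f) = f :=
  (h.eq_otherFlag (f := h.otherFlag f) (f' := f) rfl (h.otherFlag_cycle_ne f).symm).symm

/-- Both ends of a matching edge lie on the same two girth cycles, so switching cycles commutes with
moving along that edge. -/
theorem mateFlag_otherFlag (f : Γ.GirthFlag) :
    h.mateFlag (h.otherFlag f) = h.otherFlag (h.mateFlag f) :=
  h.eq_otherFlag rfl (h.otherFlag_cycle_ne f)

theorem eq_or_eq_otherFlag {f f' : Γ.GirthFlag} (hv : f'.vertex = f.vertex) :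
    f' = f ∨ f' = h.otherFlag f := by
  by_cases hc : f'.cycle = f.cycle
  · exact Or.inl (GirthFlag.ext hv hc)
  · exact Or.inr (h.eq_otherFlag hv hc)

theorem eq_mateFlag_or_eq_sideFlag {f f' : Γ.GirthFlag} (hc : f'.cycle = f.cycle)
    (ha : f.cycle.Adj f.vertex f'.vertex) : f' = h.mateFlag f ∨ f' = h.sideFlag f := by
  by_cases hv : f'.vertex = h.mate f.vertex
  · exact Or.inl (GirthFlag.ext hv hc)
  · exact Or.inr (h.eq_sideFlag hc ha hv)

theorem exists_flag (v : V) : ∃ f : Γ.GirthFlag, f.vertex = v := by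
  obtain ⟨C, hC, hv⟩ := h.exists_cycle_adj (h.adj_mate v)
  exact ⟨⟨v, C, hC, C.edge_vert hv⟩, rfl⟩

theorem exists_flags_of_adj {v w : V} (hvw : Γ.Adj v w) : ∃ f f' : Γ.GirthFlag,
    f.vertex = v ∧ f'.vertex = w ∧ f'.cycle = f.cycle ∧ f.cycle.Adj f.vertex f'.vertex := by
  obtain ⟨C, hC, hv⟩ := h.exists_cycle_adj hvw
  exact ⟨⟨v, C, hC, C.edge_vert hv⟩, ⟨w, C, hC, C.edge_vert hv.symm⟩, rfl, rfl, rfl, hv⟩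

/-- The three involutions on the flags. -/
noncomputable def flagPerm : Fin 3 → Equiv.Perm Γ.GirthFlag :=
  ![(show Function.Involutive h.mateFlag from h.mateFlag_mateFlag).toPerm,
    (show Function.Involutive h.sideFlag from h.sideFlag_sideFlag).toPerm,
    (show Function.Involutive h.otherFlag from h.otherFlag_otherFlag).toPerm]

theorem mateFlag_vertex_ne (f : Γ.GirthFlag) : (h.mateFlag f).vertex ≠ f.vertex :=
  (h.adj_mate f.vertex).ne'

/-- `r 0` and `r 1` never leave a cycle; conversely the cycle is connected and each of its edges is
a matching or a side step. -/
theorem orbitSetoid_face_iff (f f' : Γ.GirthFlag) :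
    orbitSetoid {h.flagPerm 0, h.flagPerm 1} f f' ↔ f.cycle = f'.cycle := by
  constructor
  · exact orbitSetoid_le (Setoid.comap GirthFlag.cycle ⊥) (by rintro σ (rfl | rfl) f <;> rfl)
  · obtain ⟨v, C, hC, hv⟩ := f
    obtain ⟨w, C', hC', hw⟩ := f'
    rintro (rfl : C = C')
    obtain ⟨p⟩ := hC.connected.preconnected.coe ⟨v, hv⟩ ⟨w, hw⟩
    have key : ∀ {x y : C.verts} (p : C.coe.Walk x y),
        orbitSetoid {h.flagPerm 0, h.flagPerm 1} ⟨x, C, hC, x.2⟩ ⟨y, C, hC, y.2⟩ := by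
      intro x y p
      induction p with
      | nil => exact Setoid.refl' _ _
      | @cons x y z hxy p ih =>
        refine Setoid.trans' _ (Setoid.symm' _ ?_) ih
        rcases h.eq_mateFlag_or_eq_sideFlag (f := ⟨x, C, hC, x.2⟩) (f' := ⟨y, C, hC, y.2⟩) rfl
          hxy with e | e <;> rw [e]
        · exact orbitSetoid_generator (σ := h.flagPerm 0) (by simp) _
        · exact orbitSetoid_generator (σ := h.flagPerm 1) (by simp) _
    exact key p

/-- A walk in `Γ` lifts to flags: every edge lies on a girth cycle, and `r 2` corrects the cycle at
each vertex. -/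
theorem orbitSetoid_flags (hconn : Γ.Connected) (f f' : Γ.GirthFlag) :
    orbitSetoid {h.flagPerm 0, h.flagPerm 1, h.flagPerm 2} f f' := by
  have same : ∀ f f' : Γ.GirthFlag, f.vertex = f'.vertex →
      orbitSetoid {h.flagPerm 0, h.flagPerm 1, h.flagPerm 2} f f' := by
    intro f f' e
    rcases h.eq_or_eq_otherFlag e with rfl | rfl
    · exact Setoid.refl' _ _
    · exact orbitSetoid_generator (σ := h.flagPerm 2) (by simp) _
  have key : ∀ {v w : V} (p : Γ.Walk v w) (f f' : Γ.GirthFlag), f.vertex = v → f'.vertex = w →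
      orbitSetoid {h.flagPerm 0, h.flagPerm 1, h.flagPerm 2} f f' := by
    intro v w p
    induction p with
    | nil => exact fun f f' hf hf' => same f f' (hf.trans hf'.symm)
    | cons hxy p ih =>
      intro f f' hf hf'
      obtain ⟨f₁, f₂, h1, h2, hc, ha⟩ := h.exists_flags_of_adj hxy
      refine Setoid.trans' _ (same f f₁ (hf.trans h1.symm))
        (Setoid.trans' _ (Setoid.symm' _ ?_) (ih f₂ f' h2 hf'))
      rcases h.eq_mateFlag_or_eq_sideFlag hc ha with e | e <;> rw [e]
      · exact orbitSetoid_generator (σ := h.flagPerm 0) (by simp) _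
      · exact orbitSetoid_generator (σ := h.flagPerm 1) (by simp) _
  obtain ⟨p⟩ := hconn.preconnected f.vertex f'.vertex
  exact key p f f' rfl rfl

/-- The map whose faces are the girth cycles, with the edges on two girth cycles contributing the
edges and the cycles formed by the other edges contributing the vertices. -/
noncomputable def surfaceMap [Finite V] (hconn : Γ.Connected) : SurfaceMap Γ.GirthFlag where
  r := h.flagPerm
  finite_flags := inferInstance
  nonempty_flags := by
    obtain ⟨v⟩ := hconn.nonempty
    exact ⟨(h.exists_flag v).choose⟩
  invol := by
    intro i f
    fin_cases i
    · exact h.mateFlag_mateFlag f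
    · exact h.sideFlag_sideFlag f
    · exact h.otherFlag_otherFlag f
  free := by
    intro i f e
    fin_cases i
    · exact h.mateFlag_vertex_ne f (congrArg GirthFlag.vertex e)
    · exact (h.sideGraph_adj_sideFlag f).ne' (congrArg GirthFlag.vertex e)
    · exact h.otherFlag_cycle_ne f (congrArg GirthFlag.cycle e)
  comm := h.mateFlag_otherFlag
  edge_free f e := h.mateFlag_vertex_ne (h.otherFlag f) (congrArg GirthFlag.vertex e :)
  connected := h.orbitSetoid_flags hconn
  -- The generators `r 0` and `r 1` preserve the cycle of a flag, and `r 2` changes it.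
  face_simple f e := h.otherFlag_cycle_ne f ((h.orbitSetoid_face_iff f _).1 e).symm

theorem ncard_flags_vertex (v : V) : {f : Γ.GirthFlag | f.vertex = v}.ncard = 2 := by
  obtain ⟨f, rfl⟩ := h.exists_flag v
  have e : {f' : Γ.GirthFlag | f'.vertex = f.vertex} = {f, h.otherFlag f} := by
    ext f'
    constructor
    · exact h.eq_or_eq_otherFlag
    · rintro (rfl | rfl) <;> rfl
  rw [e, Set.ncard_pair fun e => h.otherFlag_cycle_ne f (congrArg GirthFlag.cycle e).symm]

/-- Both sides count flags: two at each vertex, `g` on each girth cycle. -/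
theorem girth_mul_card_cycles [Finite V] :
    2 * Nat.card V = Γ.girth * Nat.card {C : Γ.Subgraph // Γ.IsGirthCycle C} := by
  rw [← Nat.card_eq_mul_card_of_fibers (F := Γ.GirthFlag) GirthFlag.vertex 2 h.ncard_flags_vertex]
  refine Nat.card_eq_mul_card_of_fibers (fun f => ⟨f.cycle, f.isGirthCycle⟩) _ ?_
  rintro ⟨C, hC⟩
  simpa using GirthFlag.ncard_cycle_eq hC

/-! ### Faces, arcs, vertices and automorphisms of the map -/

section Map

variable [Finite V] (hconn : Γ.Connected)

/-- The `g` flags of a girth cycle form an orbit of the free involutions `r 0` and `r 1`, which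
splits into two rotation orbits. The evenness of the girth comes from here. -/
theorem girth_eq_two_mul_faceLength (f : Γ.GirthFlag) :
    Γ.girth = 2 * (h.surfaceMap hconn).faceLength f := by
  set M := h.surfaceMap hconn
  rw [SurfaceMap.faceLength, ← ncard_orbit_of_free_involutions (M.r 0) (M.r 1) (M.invol 0)
    (M.invol 1) (M.free 0) (M.free 1), ← GirthFlag.ncard_cycle_eq f.isGirthCycle]
  congr 1
  ext f'
  exact (h.orbitSetoid_face_iff f' f).symm

theorem hasFaceLength_surfaceMap : (h.surfaceMap hconn).HasFaceLength (Γ.girth / 2) := by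
  intro f
  have := h.girth_eq_two_mul_faceLength hconn f
  omega

theorem arc_eq_arc_iff (f f' : Γ.GirthFlag) :
    (h.surfaceMap hconn).arc f = (h.surfaceMap hconn).arc f' ↔ f.vertex = f'.vertex := by
  rw [SurfaceMap.arc_eq_iff]
  constructor
  · rintro (rfl | rfl) <;> rfl
  · exact h.eq_or_eq_otherFlag

/-- The arcs of the map are the vertices of the graph. -/
noncomputable def arcEquiv : (h.surfaceMap hconn).Arc ≃ V :=
  Equiv.ofBijective (Quotient.lift GirthFlag.vertex fun f f' hf =>
      (h.arc_eq_arc_iff hconn f f').1 (Quotient.sound hf)) <| by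
    constructor
    · rintro ⟨f⟩ ⟨f'⟩ e
      exact (h.arc_eq_arc_iff hconn f f').2 e
    · intro v
      obtain ⟨f, hf⟩ := h.exists_flag v
      exact ⟨(h.surfaceMap hconn).arc f, hf⟩

theorem arcEquiv_inv (a : (h.surfaceMap hconn).Arc) :
    h.arcEquiv hconn ((h.surfaceMap hconn).skeleton.inv a) = h.mate (h.arcEquiv hconn a) := by
  obtain ⟨f⟩ := a
  rfl

theorem scheme_adj_iff (a b : (h.surfaceMap hconn).Arc) :
    h.sideGraph.Adj (h.arcEquiv hconn a) (h.arcEquiv hconn b) ↔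
      (h.surfaceMap hconn).scheme.Adj a b := by
  have step : ∀ f i, h.sideGraph.Adj
      (h.arcEquiv hconn ((h.surfaceMap hconn).skeleton.inv ((h.surfaceMap hconn).faceCycle f i)))
      (h.arcEquiv hconn ((h.surfaceMap hconn).faceCycle f (i + 1))) := by
    intro f i
    -- With `r 1 * r 0` split off on the left, the next arc is the side step from the mate of the
    -- current flag, and that mate represents the inverse arc.
    rw [SurfaceMap.faceCycle, SurfaceMap.faceCycle, pow_succ']
    exact h.sideGraph_adj_sideFlag (h.mateFlag _)
  constructor
  · intro hab
    obtain ⟨f⟩ := a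
    obtain ⟨f'⟩ := b
    refine ⟨fun e => hab.ne (congrArg _ e), Or.inl ?_⟩
    obtain ⟨f₁, f₂, h1, h2, hc, ha⟩ := h.exists_flags_of_adj hab.1
    have e : f₂ = h.sideFlag f₁ := h.eq_sideFlag hc ha (by rw [h2, h1]; exact hab.2)
    -- Starting at the mate of `f₁`, the inverse of arc 0 is the arc of `f₁`, and arc 1 is its side
    -- step.
    refine ⟨h.mateFlag f₁, 0, (h.arcEquiv hconn).injective ?_, (h.arcEquiv hconn).injective ?_⟩
    · rw [arcEquiv_inv, ← h1]
      exact (h.mate_mate _).symm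
    · have e' : f₂ = h.sideFlag (h.mateFlag (h.mateFlag f₁)) := by rw [h.mateFlag_mateFlag, e]
      exact h2.symm.trans (congrArg GirthFlag.vertex e')
  · rintro ⟨-, ⟨f, i, rfl, rfl⟩ | ⟨f, i, rfl, rfl⟩⟩
    · exact step f i
    · exact (step f i).symm

/-- The scheme of the map is the graph of the edges that lie on a single girth cycle. -/
noncomputable def schemeIso : (h.surfaceMap hconn).scheme ≃g h.sideGraph where
  toEquiv := h.arcEquiv hconn
  map_rel_iff' := h.scheme_adj_iff hconn _ _

/-- The graph is the truncation of the map. -/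
noncomputable def truncationIso : Γ ≃g (h.surfaceMap hconn).truncation :=
  RelIso.symm
    { toEquiv := h.arcEquiv hconn
      map_rel_iff' := by
        intro a b
        change _ ↔ (h.surfaceMap hconn).scheme.Adj a b ∨ b = _
        rw [← h.scheme_adj_iff hconn, ← (h.arcEquiv hconn).injective.eq_iff (a := b),
          h.arcEquiv_inv, sideGraph_adj]
        constructor
        · intro hab
          by_cases e : h.arcEquiv hconn b = h.mate (h.arcEquiv hconn a)
          · exact Or.inr e
          · exact Or.inl ⟨hab, e⟩
        · rintro (hab | e)
          · exact hab.1
          · rw [e]; exact h.adj_mate _ }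

/-- On underlying vertices `r 1` is a step along a side edge and `r 2` is the identity; every side
edge arises in this way from some flag. -/
theorem vert_eq_vert_iff (f f' : Γ.GirthFlag) :
    (h.surfaceMap hconn).vert f = (h.surfaceMap hconn).vert f' ↔
      h.sideGraph.Reachable f.vertex f'.vertex := by
  constructor
  · intro e
    refine orbitSetoid_le (Setoid.comap GirthFlag.vertex h.sideGraph.reachableSetoid) ?_
      (Quotient.exact e)
    rintro σ (rfl | rfl) f
    · exact (h.sideGraph_adj_sideFlag f).symm.reachable
    · exact Reachable.refl _
  · set M := h.surfaceMap hconn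
    have same : ∀ f f' : Γ.GirthFlag, f.vertex = f'.vertex → M.vert f = M.vert f' := fun f f' e =>
      congrArg M.skeleton.tail ((h.arc_eq_arc_iff hconn f f').2 e)
    rintro ⟨p⟩
    have key : ∀ {v w : V} (p : h.sideGraph.Walk v w) (f f' : Γ.GirthFlag),
        f.vertex = v → f'.vertex = w → M.vert f = M.vert f' := by
      intro v w p
      induction p with
      | nil => exact fun f f' hf hf' => same f f' (hf.trans hf'.symm)
      | cons hxy p ih =>
        intro f f' hf hf'
        obtain ⟨f₁, f₂, h1, h2, hc, ha⟩ := h.exists_flags_of_adj hxy.1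
        have e : f₂ = h.sideFlag f₁ := h.eq_sideFlag hc ha (by rw [h2, h1]; exact hxy.2)
        refine (same f f₁ (hf.trans h1.symm)).trans (Eq.trans ?_ (ih f₂ f' h2 hf'))
        rw [e]
        exact (Quotient.sound (orbitSetoid_generator (σ := M.r 1) (by simp) f₁)).symm
    exact key p f f' rfl rfl

theorem tail_eq_tail_iff (a b : (h.surfaceMap hconn).Arc) :
    (h.surfaceMap hconn).skeleton.tail a = (h.surfaceMap hconn).skeleton.tail b ↔
      h.sideGraph.Reachable (h.arcEquiv hconn a) (h.arcEquiv hconn b) := by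
  obtain ⟨f⟩ := a
  obtain ⟨f'⟩ := b
  exact h.vert_eq_vert_iff hconn f f'

theorem isDihedralScheme_scheme :
    (h.surfaceMap hconn).skeleton.IsDihedralScheme (h.surfaceMap hconn).scheme := by
  constructor
  · intro a
    have e : (h.surfaceMap hconn).scheme.neighborSet a =
        h.arcEquiv hconn ⁻¹' h.sideGraph.neighborSet (h.arcEquiv hconn a) := by
      ext b
      exact (h.scheme_adj_iff hconn a b).symm
    rw [e, Set.ncard_preimage_of_injective_subset_range (h.arcEquiv hconn).injective (by simp),
      h.ncard_neighborSet_sideGraph]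
  · intro a b
    rw [h.tail_eq_tail_iff]
    exact (h.schemeIso hconn).reachable_iff.symm

theorem valence_vert (f : Γ.GirthFlag) :
    (h.surfaceMap hconn).skeleton.valence ((h.surfaceMap hconn).vert f) =
      {w | h.sideGraph.Reachable f.vertex w}.ncard := by
  have e : {a | (h.surfaceMap hconn).skeleton.tail a = (h.surfaceMap hconn).vert f} =
      h.arcEquiv hconn ⁻¹' {w | h.sideGraph.Reachable f.vertex w} := by
    ext a
    exact (h.tail_eq_tail_iff hconn a ((h.surfaceMap hconn).arc f)).trans
      ⟨Reachable.symm, Reachable.symm⟩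
  rw [ArcGraph.valence, e,
    Set.ncard_preimage_of_injective_subset_range (h.arcEquiv hconn).injective (by simp)]

/-- Each of the three moves is characterised uniquely by data that an automorphism of `Γ` preserves:
the matching, adjacency in the cycle, and distinctness of cycles. -/
theorem mapPerm_mem_aut (φ : Γ ≃g Γ) : GirthFlag.mapPerm φ ∈ (h.surfaceMap hconn).Aut := by
  rw [SurfaceMap.Aut, Subgroup.mem_centralizer_iff]
  rintro _ ⟨i, rfl⟩
  ext1 f
  symm
  fin_cases i
  · exact GirthFlag.ext (h.map_mate φ f.vertex) rfl
  · refine h.eq_sideFlag rfl ⟨_, _, h.adj_sideFlag f, rfl, rfl⟩ ?_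
    change φ _ ≠ h.mate (φ f.vertex)
    rw [← h.map_mate φ]
    exact φ.injective.ne (h.sideFlag_ne_mate f)
  · exact h.eq_otherFlag rfl ((Subgraph.map_iso_injective φ).ne (h.otherFlag_cycle_ne f))

theorem isArcTransitive_surfaceMap (ht : Γ.IsVertexTransitive) :
    (h.surfaceMap hconn).IsArcTransitive := by
  intro f f'
  obtain ⟨φ, hφ⟩ := ht f.vertex f'.vertex
  exact ⟨GirthFlag.mapPerm φ, h.mapPerm_mem_aut hconn φ, (h.arc_eq_arc_iff hconn _ _).2 hφ⟩

/-- The action of an automorphism of the graph on the edges that lie on a single girth cycle. -/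
def sideGraphIso (φ : Γ ≃g Γ) : h.sideGraph ≃g h.sideGraph where
  toEquiv := φ.toEquiv
  map_rel_iff' {v w} := by
    change Γ.Adj (φ v) (φ w) ∧ φ w ≠ h.mate (φ v) ↔ Γ.Adj v w ∧ w ≠ h.mate v
    rw [φ.map_adj_iff, ← h.map_mate φ, φ.injective.ne_iff]

theorem ncard_reachable_eq (ht : Γ.IsVertexTransitive) (v w : V) :
    {x | h.sideGraph.Reachable v x}.ncard = {x | h.sideGraph.Reachable w x}.ncard := by
  obtain ⟨φ, rfl⟩ := ht v w
  have e : {x | h.sideGraph.Reachable v x} =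
      φ ⁻¹' {x | h.sideGraph.Reachable (φ v) x} := by
    ext x
    exact (h.sideGraphIso φ).reachable_iff.symm
  rw [e, Set.ncard_preimage_of_injective_subset_range φ.injective
    (by rw [φ.surjective.range_eq]; exact Set.subset_univ _)]

end Map

end HasSignatureOneOneTwo

end SimpleGraph

theorem mainTheorem7 {V : Type u} [Fintype V] [DecidableEq V]
    (Γ : SimpleGraph V) [DecidableRel Γ.Adj]
    (hconn : Γ.Connected) (hcubic : Γ.IsRegularOfDegree 3)
    (hreg : Γ.IsGirthRegular) (hsig : ∀ v : V, Γ.signature v = [1, 1, 2]) :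
    Even Γ.girth ∧
    Γ.girth / 2 ∣ Fintype.card V ∧
    ∃ (F : Type u) (M : SurfaceMap F),
      M.HasFaceLength (Γ.girth / 2) ∧
      M.skeleton.IsDihedralScheme M.scheme ∧
      Nonempty (Γ ≃g M.truncation) ∧
      (Γ.IsVertexTransitive →
        M.IsArcTransitive ∧ ∃ ℓ : ℕ, Γ.girth < ℓ ∧ M.IsOfType (Γ.girth / 2) ℓ) := by
  have h := SimpleGraph.hasSignatureOneOneTwo_of_signature_eq hsig
  have heven : ∃ k, Γ.girth = 2 * k := by
    obtain ⟨f⟩ := (h.surfaceMap hconn).nonempty_flags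
    exact ⟨_, h.girth_eq_two_mul_faceLength hconn f⟩
  refine ⟨even_iff_exists_two_mul.2 heven, ?_, Γ.GirthFlag, h.surfaceMap hconn,
    h.hasFaceLength_surfaceMap hconn, h.isDihedralScheme_scheme hconn, ⟨h.truncationIso hconn⟩, ?_⟩
  · obtain ⟨k, hk⟩ := heven
    -- The cofactor is the number of girth cycles: cancel 2 in `2n = g · #cycles`.
    refine ⟨Nat.card {C : Γ.Subgraph // Γ.IsGirthCycle C}, ?_⟩
    have := h.girth_mul_card_cycles
    rw [hk, mul_assoc, Nat.card_eq_fintype_card (α := V)] at this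
    rw [hk, Nat.mul_div_cancel_left k two_pos]
    exact Nat.eq_of_mul_eq_mul_left two_pos this
  · intro ht
    obtain ⟨v⟩ := hconn.nonempty
    -- Here `ℓ` is the size of the side component of `v`, which by transitivity is the size of every
    -- side component.
    refine ⟨h.isArcTransitive_surfaceMap hconn ht, _, h.girth_lt_ncard_reachable v,
      h.hasFaceLength_surfaceMap hconn, ?_⟩
    rintro ⟨f⟩
    exact (h.valence_vert hconn f).trans (h.ncard_reachable_eq ht _ _)
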